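/- Let $1<\alpha\le 2$, $T,N\in\mathbb N$, $\vec a(0),\dots,\vec a(N)\in\mathbb C^T$, $A_N(e^{i\theta})=\sum_{j=0}^N\vec a(j)e^{ij\theta}$, and write $z^{<\beta>}=|z|^{\beta-1}\bar z$ (componentwise for vectors). A $T\times T$ matrix function $f$ on $[-\pi,\pi]$ is a *spectral density* if it is the density of the (finite) matrix spectral measure of a $\mathbb C^T$-valued symmetric $\alpha$-stable process $\vec Z$ on $[-\pi,\pi]$ with independent increments, that is, $[\int \vec x^{\top}d\vec Z,\int\vec y^{\top}d\vec Z]_\alpha=\int_{-\pi}^{\pi}\vec x(\theta)^{\top}f(\theta)\,\vec y(\theta)^{<\alpha-1>}\,d\theta$ for all bounded measurable $\vec x,\vec y$, where $[\cdot,\cdot]_\alpha$ is the covariation; a harmonizable symmetric $\alpha$-stable sequence $\vec\xi(n)=\int_{-\pi}^{\pi}e^{in\theta}d\vec Z(\theta)$ then has spectral density $f$. Let $\|X\|_\alpha^\alpha=[X,X]_\alpha$. For a spectral density $w$ let $L^\alpha(w)$ be the space of vector functions $h$ with $\int_{-\pi}^{\pi}h^{\top}w\,h^{<\alpha-1>}d\theta<\infty$,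 normed by the $\alpha$-th root of this integral, and let $L^\alpha_N(w)$ be the closed linear span in it of the functions $e^{ij\theta}\delta_k$, $k=1,\dots,T$, $j\in\mathbb Z\setminus\{0,\dots,N\}$. Put $$\Delta(h;f,g)=\int_{-\pi}^{\pi}(A_N-h)^{\top}f\,(A_N-h)^{<\alpha-1>}d\theta+\int_{-\pi}^{\pi}h^{\top}g\,h^{<\alpha-1>}d\theta,\qquad \Delta(f,g)=\inf_{h\in L^\alpha_N(f+g)}\Delta(h;f,g).$$ Let $D_f,D_g$ be sets of spectral densities and $H_D=\bigcap_{(f,g)\in D_f\times D_g}L^\alpha_N(f+g)$. Let $\vec\xi,\vec\eta$ be mutually independent $\mathbb C^T$-valued harmonizable symmetric $\alpha$-stable sequences with spectral densities $f_0\in D_f$, $g_0\in D_g$ satisfying the minimality condition $\int_{-\pi}^{\pi}\mathrm{Tr}[(f_0+g_0)^{-1/(\alpha-1)}]\,d\theta<\infty$ (with $f_0+g_0$ positive definite almost everywhere). Let $h^0=h(f_0,g_0)\in L^\alpha_N(f_0+g_0)$ be the spectral characteristic of the optimal linear estimate $\hat A_N\vec\xi=\int (h^0)^{\top}(d\vec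 Z^{\xi}+d\vec Z^{\eta})$ of $A_N\vec\xi=\sum_{j=0}^N\vec a(j)^{\top}\vec\xi(j)$, i.e. of a point of the $\|\cdot\|_\alpha$-closed linear span of $\{\xi_k(j)+\eta_k(j): 1\le k\le T,\ j\in\mathbb Z\setminus\{0,\dots,N\}\}$ at least $\|\cdot\|_\alpha$-distance from $A_N\vec\xi$. Suppose that $(f_0,g_0)$ solves the constrained problem $$\max_{(f,g)\in D_f\times D_g}\Delta(h^0;f,g)=\Delta(h^0;f_0,g_0)$$ and that $h^0\in H_D$. Then: 1. $f_0,g_0$ are least favorable in $D_f\times D_g$: $\Delta(h^0;f_0,g_0)=\Delta(f_0,g_0)=\max_{(f,g)\in D_f\times D_g}\Delta(f,g)$; 2. $h^0$ is a minimax (robust) spectral characteristic: $h^0\in H_D$, $\max_{(f,g)\in D_f\times D_g}\Delta(h^0;f,g)$ exists, and it equals $\min_{h\in H_D}\sup_{(f,g)\in D_f\times D_g}\Delta(h;f,g)$. -/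

import Mathlib

open MeasureTheory ProbabilityTheory Filter Topology
open scoped ENNReal Matrix ComplexConjugate ComplexOrder

noncomputable section

namespace HSaS

/-! ### Symmetric stable variables and their covariation norm -/

/-- The signed power `z^{<β>} = |z|^{β-1} z̄`. -/
def spow (β : ℝ) (z : ℂ) : ℂ := ((‖z‖ ^ (β - 1) : ℝ) : ℂ) * conj z

/-- `Γ` is the spectral measure of the symmetric `α`-stable complex variable `X`: a finite symmetric
measure on the unit circle with `E exp(i Re(zX)) = exp(-∫ |Re(zs)|^α dΓ(s))` for all complex `z`
(this is the characteristic function of the pair `(Re X, Im X)`). -/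
structure IsSpectralMeasure {Ω : Type*} [MeasurableSpace Ω] (α : ℝ) (P : Measure Ω) (X : Ω → ℂ)
    (Γ : Measure ℂ) : Prop where
  finite : IsFiniteMeasure Γ
  sphere : ∀ᵐ s ∂Γ, ‖s‖ = 1
  symm : Γ.map (fun s => -s) = Γ
  charFun_eq : ∀ z : ℂ, ∫ ω, Complex.exp (Complex.I * ((z * X ω).re : ℂ)) ∂P
    = Complex.exp (-((∫ s, |(z * s).re| ^ α ∂Γ : ℝ) : ℂ))

/-- `‖X‖_α^α = [X, X]_α = ∫ s s^{<α-1>} dΓ(s) = ∫ |s|^α dΓ(s)` with `Γ` the spectral measure of `X`.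
All spectral measures of `X` give the same value; it is `⊤` if `X` is not symmetric `α`-stable. -/
def stableNormPow {Ω : Type*} [MeasurableSpace Ω] (α : ℝ) (P : Measure Ω) (X : Ω → ℂ) : ℝ≥0∞ :=
  ⨅ (Γ : Measure ℂ) (_ : IsSpectralMeasure α P X Γ), ∫⁻ s, ENNReal.ofReal (‖s‖ ^ α) ∂Γ

/-! ### Harmonizable sequences and matrix spectral densities -/

/-- `xᵀ M y^{<α-1>}`, the power being taken componentwise. -/
def covForm {T : ℕ} (α : ℝ) (M : Matrix (Fin T) (Fin T) ℂ) (x y : Fin T → ℂ) : ℂ :=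
  x ⬝ᵥ (M *ᵥ fun k => spow (α - 1) (y k))

/-- The matrix function `f` is the density of the matrix spectral measure of a vector-valued
symmetric `α`-stable process `Z` on `[-π, π]` with independent increments whose law is given by the
finite measure `Γ` on `[-π, π] × (unit sphere of ℂ^T)`:
`E exp(i Re ∫ xᵀ dZ) = exp(-∫ |Re(x(θ)ᵀ s)|^α dΓ(θ, s))`.
The left side of `covariation` is `[∫ xᵀ dZ, ∫ yᵀ dZ]_α`, so the identity reads
`[∫ xᵀ dZ, ∫ yᵀ dZ]_α = ∫ xᵀ f y^{<α-1>} dθ`. -/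
structure IsDensityOf {T : ℕ} (α : ℝ) (Γ : Measure (ℝ × (Fin T → ℂ)))
    (f : ℝ → Matrix (Fin T) (Fin T) ℂ) : Prop where
  finite : IsFiniteMeasure Γ
  sphere : ∀ᵐ p ∂Γ, p.1 ∈ Set.Icc (-Real.pi) Real.pi ∧ ∑ k, ‖p.2 k‖ ^ 2 = 1
  symm : Γ.map (fun p => (p.1, -p.2)) = Γ
  integrable : ∀ k l, IntegrableOn (fun θ => f θ k l) (Set.Icc (-Real.pi) Real.pi)
  covariation : ∀ x y : ℝ → Fin T → ℂ, Measurable x → Measurable y →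
    (∃ C : ℝ, ∀ θ k, ‖x θ k‖ ≤ C) → (∃ C : ℝ, ∀ θ k, ‖y θ k‖ ≤ C) →
    ∫ p, (x p.1 ⬝ᵥ p.2) * spow (α - 1) (y p.1 ⬝ᵥ p.2) ∂Γ
      = ∫ θ in Set.Icc (-Real.pi) Real.pi, covForm α (f θ) (x θ) (y θ)

/-- `f` is the spectral density of some vector-valued symmetric `α`-stable process on `[-π, π]` with
independent increments and finite spectral measure. -/
def IsSpectralDensity {T : ℕ} (α : ℝ) (f : ℝ → Matrix (Fin T) (Fin T) ℂ) : Prop :=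
  ∃ Γ : Measure (ℝ × (Fin T → ℂ)), IsDensityOf α Γ f

/-- The vector trigonometric polynomial `∑ⱼ c(j) e^{ijθ}`. -/
def trigPoly {T : ℕ} (c : ℤ →₀ (Fin T → ℂ)) (θ : ℝ) : Fin T → ℂ :=
  ∑ j ∈ c.support, Complex.exp (Complex.I * ((j * θ : ℝ) : ℂ)) • c j

/-- The random variable `∑ⱼ c(j)ᵀ ζ(j)`. -/
def linComb {Ω : Type*} {T : ℕ} (c : ℤ →₀ (Fin T → ℂ)) (ζ : ℤ → Ω → Fin T → ℂ) (ω : Ω) : ℂ :=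
  ∑ j ∈ c.support, c j ⬝ᵥ ζ j ω

/-- `ξ` is a vector-valued harmonizable symmetric `α`-stable sequence with spectral density `f`: its
finite-dimensional laws are those of `ξ(n) = ∫ e^{inθ} dZ(θ)` for a process `Z` as in
`IsDensityOf`. -/
def IsHarmonizable {Ω : Type*} [MeasurableSpace Ω] {T : ℕ} (α : ℝ) (P : Measure Ω)
    (ξ : ℤ → Ω → Fin T → ℂ) (f : ℝ → Matrix (Fin T) (Fin T) ℂ) : Prop :=
  (∀ n, Measurable (ξ n)) ∧
  ∃ Γ : Measure (ℝ × (Fin T → ℂ)), IsDensityOf α Γ f ∧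
    ∀ c : ℤ →₀ (Fin T → ℂ),
      ∫ ω, Complex.exp (Complex.I * ((linComb c ξ ω).re : ℂ)) ∂P
        = Complex.exp (-((∫ p, |(trigPoly c p.1 ⬝ᵥ p.2).re| ^ α ∂Γ : ℝ) : ℂ))

/-- The minimality condition `∫ Tr[(f + g)^{-1/(α-1)}] dθ < ∞`. -/
def MinimalityCondition {T : ℕ} (α : ℝ) (f g : ℝ → Matrix (Fin T) (Fin T) ℂ) : Prop :=
  (∀ᵐ θ ∂(volume.restrict (Set.Icc (-Real.pi) Real.pi)), (f θ + g θ).PosDef) ∧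
  IntegrableOn
    (fun θ => (Matrix.trace (cfc (fun x : ℝ => x ^ (-1 / (α - 1))) (f θ + g θ))).re)
    (Set.Icc (-Real.pi) Real.pi)

/-! ### The interpolation problem with noise -/

/-- The frequencies (times) `0, 1, …, N` do not occur in `c`. -/
def AvoidsGap {T : ℕ} (N : ℕ) (c : ℤ →₀ (Fin T → ℂ)) : Prop :=
  ∀ j ∈ c.support, j ∉ Set.Icc (0 : ℤ) N

/-- `A_N(e^{iθ}) = ∑_{j=0}^N a(j) e^{ijθ}`. -/
def symbolA {T : ℕ} (N : ℕ) (a : ℕ → Fin T → ℂ) (θ : ℝ) : Fin T → ℂ :=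
  ∑ j ∈ Finset.range (N + 1), Complex.exp (Complex.I * ((j * θ : ℝ) : ℂ)) • a j

/-- `A_N ξ = ∑_{j=0}^N a(j)ᵀ ξ(j)`. -/
def functionalA {Ω : Type*} {T : ℕ} (N : ℕ) (a : ℕ → Fin T → ℂ) (ξ : ℤ → Ω → Fin T → ℂ)
    (ω : Ω) : ℂ :=
  ∑ j ∈ Finset.range (N + 1), a j ⬝ᵥ ξ j ω

/-- `Y` belongs to `H^N(ζ)`, the `‖·‖_α`-closed linear span of the `ζ_k(j)`,
`j ∈ ℤ \ {0, …, N}`. -/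
def IsLinearEstimate {Ω : Type*} [MeasurableSpace Ω] {T : ℕ} (α : ℝ) (P : Measure Ω) (N : ℕ)
    (ζ : ℤ → Ω → Fin T → ℂ) (Y : Ω → ℂ) : Prop :=
  Measurable Y ∧ ∃ c : ℕ → (ℤ →₀ (Fin T → ℂ)), (∀ m, AvoidsGap N (c m)) ∧
    Tendsto (fun m => stableNormPow α P (fun ω => linComb (c m) ζ ω - Y ω)) atTop (𝓝 0)

/-- `Y` is the optimal linear estimate of `A_N ξ` from the observations `ξ(j) + η(j)`,
`j ∈ ℤ \ {0, …, N}`: a projection of `A_N ξ` on `H^N(ξ + η)`. -/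
def IsOptimalEstimate {Ω : Type*} [MeasurableSpace Ω] {T : ℕ} (α : ℝ) (P : Measure Ω) (N : ℕ)
    (a : ℕ → Fin T → ℂ) (ξ η : ℤ → Ω → Fin T → ℂ) (Y : Ω → ℂ) : Prop :=
  IsLinearEstimate α P N (ξ + η) Y ∧
  ∀ Y', IsLinearEstimate α P N (ξ + η) Y' →
    stableNormPow α P (fun ω => functionalA N a ξ ω - Y ω)
      ≤ stableNormPow α P (fun ω => functionalA N a ξ ω - Y' ω)

/-- `∫ hᵀ w h^{<α-1>} dθ`, the `α`-th power of the norm of `L^α(w)`. For a spectral density `w` the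
integrand is real and nonnegative almost everywhere. -/
def normPow {T : ℕ} (α : ℝ) (w : ℝ → Matrix (Fin T) (Fin T) ℂ) (h : ℝ → Fin T → ℂ) : ℝ≥0∞ :=
  ∫⁻ θ in Set.Icc (-Real.pi) Real.pi, ENNReal.ofReal (covForm α (w θ) (h θ) (h θ)).re

/-- `L_N^α(w)`: the closed linear span in `L^α(w)` of the functions `e^{ijθ} δ_k`,
`j ∈ ℤ \ {0, …, N}`. -/
def estimateSpace {T : ℕ} (α : ℝ) (N : ℕ) (w : ℝ → Matrix (Fin T) (Fin T) ℂ) :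
    Set (ℝ → Fin T → ℂ) :=
  {h | Measurable h ∧ ∃ c : ℕ → (ℤ →₀ (Fin T → ℂ)), (∀ m, AvoidsGap N (c m)) ∧
    Tendsto (fun m => normPow α w (fun θ => trigPoly (c m) θ - h θ)) atTop (𝓝 0)}

/-- `h` is the spectral characteristic of the estimate `Y ∈ H^N(ξ + η)`, that is,
`Y = ∫ hᵀ (dZ^ξ + dZ^η)`: `Y` and `h` correspond to each other under the extension by continuity of
`ξ_k(j) + η_k(j) ↔ e^{ijθ} δ_k`. -/
def IsCharacteristicOf {Ω : Type*} [MeasurableSpace Ω] {T : ℕ} (α : ℝ) (P : Measure Ω) (N : ℕ)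
    (ξ η : ℤ → Ω → Fin T → ℂ) (f g : ℝ → Matrix (Fin T) (Fin T) ℂ) (Y : Ω → ℂ)
    (h : ℝ → Fin T → ℂ) : Prop :=
  Measurable h ∧ ∃ c : ℕ → (ℤ →₀ (Fin T → ℂ)), (∀ m, AvoidsGap N (c m)) ∧
    Tendsto (fun m => stableNormPow α P (fun ω => linComb (c m) (ξ + η) ω - Y ω)) atTop (𝓝 0) ∧
    Tendsto (fun m => normPow α (f + g) (fun θ => trigPoly (c m) θ - h θ)) atTop (𝓝 0)

/-- `h = h(f, g)`: the spectral characteristic of the optimal linear estimate of `A_N ξ`. -/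
def IsOptimalCharacteristic {Ω : Type*} [MeasurableSpace Ω] {T : ℕ} (α : ℝ) (P : Measure Ω) (N : ℕ)
    (a : ℕ → Fin T → ℂ) (ξ η : ℤ → Ω → Fin T → ℂ) (f g : ℝ → Matrix (Fin T) (Fin T) ℂ)
    (h : ℝ → Fin T → ℂ) : Prop :=
  ∃ Y : Ω → ℂ, IsOptimalEstimate α P N a ξ η Y ∧ IsCharacteristicOf α P N ξ η f g Y h

/-! ### Minimax notions -/

/-- `Δ(h; f, g) = ∫ (A_N - h)ᵀ f (A_N - h)^{<α-1>} dθ + ∫ hᵀ g h^{<α-1>} dθ`. -/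
def estError {T : ℕ} (α : ℝ) (N : ℕ) (a : ℕ → Fin T → ℂ) (h : ℝ → Fin T → ℂ)
    (f g : ℝ → Matrix (Fin T) (Fin T) ℂ) : ℝ≥0∞ :=
  normPow α f (fun θ => symbolA N a θ - h θ) + normPow α g h

/-- `Δ(f, g) = Δ(h(f, g); f, g)`, the least value of `Δ(h; f, g)` for `h ∈ L_N^α(f + g)`. -/
def optimalError {T : ℕ} (α : ℝ) (N : ℕ) (a : ℕ → Fin T → ℂ)
    (f g : ℝ → Matrix (Fin T) (Fin T) ℂ) : ℝ≥0∞ :=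
  ⨅ h ∈ estimateSpace α N (f + g), estError α N a h f g

/-- `H_D`, the intersection of the spaces `L_N^α(f + g)` over `(f, g) ∈ D_f × D_g`. -/
def commonSpace {T : ℕ} (α : ℝ) (N : ℕ) (Df Dg : Set (ℝ → Matrix (Fin T) (Fin T) ℂ)) :
    Set (ℝ → Fin T → ℂ) :=
  {h | ∀ f ∈ Df, ∀ g ∈ Dg, h ∈ estimateSpace α N (f + g)}

/-- `(f₀, g₀)` solves the constrained problem
`max_{(f, g) ∈ D_f × D_g} Δ(h₀; f, g) = Δ(h₀; f₀, g₀)`. -/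
def SolvesConstrained {T : ℕ} (α : ℝ) (N : ℕ) (a : ℕ → Fin T → ℂ)
    (Df Dg : Set (ℝ → Matrix (Fin T) (Fin T) ℂ)) (h₀ : ℝ → Fin T → ℂ)
    (f₀ g₀ : ℝ → Matrix (Fin T) (Fin T) ℂ) : Prop :=
  f₀ ∈ Df ∧ g₀ ∈ Dg ∧ ∀ f ∈ Df, ∀ g ∈ Dg, estError α N a h₀ f g ≤ estError α N a h₀ f₀ g₀

/-- `f₀ ∈ D_f`, `g₀ ∈ D_g` are least favorable in `D_f × D_g`. -/
def IsLeastFavorable {T : ℕ} (α : ℝ) (N : ℕ) (a : ℕ → Fin T → ℂ)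
    (Df Dg : Set (ℝ → Matrix (Fin T) (Fin T) ℂ)) (f₀ g₀ : ℝ → Matrix (Fin T) (Fin T) ℂ) : Prop :=
  f₀ ∈ Df ∧ g₀ ∈ Dg ∧ ∀ f ∈ Df, ∀ g ∈ Dg, optimalError α N a f g ≤ optimalError α N a f₀ g₀

/-- `sup_{(f, g) ∈ D_f × D_g} Δ(h; f, g)`. -/
def worstError {T : ℕ} (α : ℝ) (N : ℕ) (a : ℕ → Fin T → ℂ)
    (Df Dg : Set (ℝ → Matrix (Fin T) (Fin T) ℂ)) (h : ℝ → Fin T → ℂ) : ℝ≥0∞ :=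
  ⨆ f ∈ Df, ⨆ g ∈ Dg, estError α N a h f g

/-- `h₀` is a minimax (robust) spectral characteristic: `h₀ ∈ H_D`, the maximum of `Δ(h₀; f, g)` over
`D_f × D_g` is attained, and `h₀` minimizes the worst error over `H_D`. -/
def IsMinimaxCharacteristic {T : ℕ} (α : ℝ) (N : ℕ) (a : ℕ → Fin T → ℂ)
    (Df Dg : Set (ℝ → Matrix (Fin T) (Fin T) ℂ)) (h₀ : ℝ → Fin T → ℂ) : Prop :=
  h₀ ∈ commonSpace α N Df Dg ∧
  (∃ f ∈ Df, ∃ g ∈ Dg, worstError α N a Df Dg h₀ = estError α N a h₀ f g) ∧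
  ∀ h ∈ commonSpace α N Df Dg, worstError α N a Df Dg h₀ ≤ worstError α N a Df Dg h

end HSaS

end

/-!
The error of the estimate with spectral characteristic `h` is
`∫ (A_N - h)ᵀ dZ^ξ - ∫ hᵀ dZ^η`. By independence, it is the integral of `(A_N - h, -h)` against a
symmetric stable random measure on the disjoint union of the two control spaces, so its `‖·‖_α^α`
is `Δ(h; f, g)`. Here the spectral measure of a variable need not be recovered from its
characteristic function: averaging the characteristic exponent `z ↦ ∫ |Re(z u)|^α dμ` over the unit
disc gives a constant multiple of `∫ |u|^α dμ`, since `|Re(z w)|^α` has average proportional to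
`|w|^α` by rotation invariance. Both sides are continuous along the approximating trigonometric
polynomials, so the identity passes to the closed spans, and the characteristic `h⁰` of the optimal
estimate minimizes `Δ(·; f₀, g₀)` over `L_N^α(f₀ + g₀)`. As `(f₀, g₀)` maximizes `Δ(h⁰; ·, ·)`, the
point `(h⁰; f₀, g₀)` is a saddle point of `Δ`, which gives both assertions.
-/

namespace HSaS

theorem ofReal_norm_rpow {V : Type*} [NormedAddCommGroup V] {α : ℝ} (hα : 0 ≤ α) (v : V) :
    ENNReal.ofReal (‖v‖ ^ α) = ‖v‖ₑ ^ α := by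
  rw [← ENNReal.ofReal_rpow_of_nonneg (norm_nonneg _) hα, ofReal_norm]

theorem integral_norm_rpow_eq_toReal {E V : Type*} [MeasurableSpace E] [NormedAddCommGroup V]
    {μ : Measure E} {α : ℝ} (hα : 0 ≤ α) {v : E → V} (hv : AEStronglyMeasurable v μ) :
    ∫ e, ‖v e‖ ^ α ∂μ = (∫⁻ e, ‖v e‖ₑ ^ α ∂μ).toReal := by
  rw [integral_eq_lintegral_of_nonneg_ae (ae_of_all _ fun e => by positivity)
    (hv.norm.aemeasurable.pow_const α).aestronglyMeasurable]
  simp only [ofReal_norm_rpow hα]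

theorem tendsto_lintegral_enorm_rpow {E V : Type*} [MeasurableSpace E] [NormedAddCommGroup V]
    {μ : Measure E} {α : ℝ} (hα : 1 ≤ α) {v : ℕ → E → V} {w : E → V}
    (hv : ∀ m, AEStronglyMeasurable (v m) μ) (hw : AEStronglyMeasurable w μ)
    (h : Tendsto (fun m => ∫⁻ e, ‖v m e - w e‖ₑ ^ α ∂μ) atTop (𝓝 0)) :
    Tendsto (fun m => ∫⁻ e, ‖v m e‖ₑ ^ α ∂μ) atTop (𝓝 (∫⁻ e, ‖w e‖ₑ ^ α ∂μ)) := by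
  have hα0 : 0 < α := by positivity
  have hdist : Tendsto (fun m => eLpNorm' (v m - w) α μ) atTop (𝓝 0) := by
    have := h.ennrpow_const (1 / α)
    rwa [ENNReal.zero_rpow_of_pos (by positivity)] at this
  simp only [lintegral_rpow_enorm_eq_rpow_eLpNorm' hα0]
  refine Tendsto.ennrpow_const α ?_
  have hlower : Tendsto (fun m => eLpNorm' w α μ - eLpNorm' (v m - w) α μ) atTop
      (𝓝 (eLpNorm' w α μ)) := by
    simpa using ENNReal.Tendsto.sub tendsto_const_nhds hdist (Or.inr ENNReal.zero_ne_top)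
  have hupper : Tendsto (fun m => eLpNorm' w α μ + eLpNorm' (v m - w) α μ) atTop
      (𝓝 (eLpNorm' w α μ)) := by
    simpa using tendsto_const_nhds.add hdist
  refine tendsto_of_tendsto_of_tendsto_of_le_of_le hlower hupper (fun m => ?_) fun m => ?_
  · have := eLpNorm'_add_le (hv m) (hw.sub (hv m)) hα
    rwa [add_sub_cancel, ← neg_sub (v m) w, eLpNorm'_neg, ← tsub_le_iff_right] at this
  · simpa using eLpNorm'_add_le hw ((hv m).sub hw) hα

theorem lintegral_enorm_rpow_lt_top_of_tendsto {E V : Type*} [MeasurableSpace E]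
    [NormedAddCommGroup V] {μ : Measure E} {α : ℝ} (hα : 1 ≤ α) {v : ℕ → E → V} {w : E → V}
    (hv : ∀ m, AEStronglyMeasurable (v m) μ) (hfin : ∀ m, ∫⁻ e, ‖v m e‖ₑ ^ α ∂μ < ⊤)
    (h : Tendsto (fun m => ∫⁻ e, ‖v m e - w e‖ₑ ^ α ∂μ) atTop (𝓝 0)) :
    ∫⁻ e, ‖w e‖ₑ ^ α ∂μ < ⊤ := by
  obtain ⟨m, hm⟩ := (h.eventually_lt_const ENNReal.zero_lt_top).exists
  refine (lintegral_mono fun e => ?_).trans_lt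
    (ENNReal.lintegral_rpow_add_lt_top_of_lintegral_rpow_lt_top (hv m).enorm (hfin m) hm hα)
  refine ENNReal.rpow_le_rpow ?_ (by positivity)
  simpa using enorm_sub_le (a := v m e) (b := v m e - w e)

theorem enorm_re_le (z : ℂ) : ‖z.re‖ₑ ≤ ‖z‖ₑ :=
  enorm_le_iff_norm_le.2 (Complex.abs_re_le_norm z)

/-- The integral of `|Re z|^α` over the unit disc: the factor by which averaging
`z ↦ |Re(z w)|^α` over the disc multiplies `|w|^α`. -/
noncomputable def discConst (α : ℝ) : ℝ≥0∞ := ∫⁻ z in Metric.ball (0 : ℂ) 1, ‖z.re‖ₑ ^ α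

theorem discConst_ne_top {α : ℝ} (hα : 0 ≤ α) : discConst α ≠ ⊤ := by
  refine ne_top_of_le_ne_top (b := ∫⁻ _ in Metric.ball (0 : ℂ) 1, 1) (by simp)
    (setLIntegral_mono measurable_const fun z hz => ENNReal.rpow_le_one ?_ hα)
  refine (enorm_re_le z).trans ?_
  simpa [← ofReal_norm] using (mem_ball_zero_iff.1 hz).le

theorem discConst_ne_zero {α : ℝ} (hα : 0 < α) : discConst α ≠ 0 := by
  refine (setLIntegral_pos_iff (by fun_prop)).2 ?_ |>.ne'
  have hopen : IsOpen ({z : ℂ | z.re ≠ 0} ∩ Metric.ball 0 1) :=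
    (isOpen_ne_fun Complex.continuous_re continuous_const).inter Metric.isOpen_ball
  have hmem : (1 / 2 : ℂ) ∈ {z : ℂ | z.re ≠ 0} ∩ Metric.ball 0 1 := by norm_num
  refine (hopen.measure_pos volume ⟨_, hmem⟩).trans_le
    (measure_mono (Set.inter_subset_inter_left _ fun z (hz : z.re ≠ 0) => ?_))
  simp [hz, hα]

theorem setLIntegral_ball_comp_mul_of_norm_eq_one {w : ℂ} (hw : ‖w‖ = 1) {F : ℂ → ℝ≥0∞}
    (hF : Measurable F) (r : ℝ) :
    ∫⁻ z in Metric.ball (0 : ℂ) r, F (z * w) = ∫⁻ z in Metric.ball (0 : ℂ) r, F z := by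
  obtain ⟨u, rfl⟩ : ∃ u : Circle, (u : ℂ) = w := ⟨⟨w, mem_sphere_zero_iff_norm.2 hw⟩, rfl⟩
  have hball : rotation u ⁻¹' Metric.ball (0 : ℂ) r = Metric.ball 0 r := by
    rw [LinearIsometryEquiv.preimage_ball, map_zero]
  have hrot := (rotation u).measurePreserving.setLIntegral_comp_preimage
    (s := Metric.ball 0 r) Metric.isOpen_ball.measurableSet hF
  simpa only [hball, rotation_apply, mul_comm (u : ℂ)] using hrot

theorem setLIntegral_ball_enorm_re_mul {α : ℝ} (hα : 0 < α) (w : ℂ) :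
    ∫⁻ z in Metric.ball (0 : ℂ) 1, ‖(z * w).re‖ₑ ^ α = ‖w‖ₑ ^ α * discConst α := by
  rcases eq_or_ne w 0 with rfl | hw
  · simp [hα]
  have hpolar (z : ℂ) : ‖(z * w).re‖ₑ ^ α = ‖w‖ₑ ^ α * ‖(z * (w / ‖w‖)).re‖ₑ ^ α := by
    have hw' : (‖w‖ : ℂ) ≠ 0 := by simpa using hw
    have hzw : z * w = (‖w‖ : ℂ) * (z * (w / ‖w‖)) := by field_simp
    rw [← ENNReal.mul_rpow_of_nonneg _ _ hα.le, hzw, Complex.re_ofReal_mul, enorm_mul, enorm_norm]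
  simp only [hpolar]
  rw [lintegral_const_mul _ (by fun_prop), setLIntegral_ball_comp_mul_of_norm_eq_one
    (F := fun z => ‖z.re‖ₑ ^ α) (by simp [hw]) (by fun_prop), discConst]

/-! ### Stable integrals -/

section StableIntegral

variable {Ω E : Type*} [MeasurableSpace Ω] [MeasurableSpace E] {α : ℝ} {P : Measure Ω}
  {X Y : Ω → ℂ} {μ : Measure E} {u : E → ℂ}

/-- The characteristic function `z ↦ E exp(i Re(z X))` of the complex random variable `X`, that is,
of the pair `(Re X, Im X)`. -/
noncomputable def complexCharFun (P : Measure Ω) (X : Ω → ℂ) (z : ℂ) : ℂ :=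
  ∫ ω, Complex.exp (Complex.I * ((z * X ω).re : ℂ)) ∂P

/-- The characteristic exponent `z ↦ ∫ |Re(z u)|^α dμ` of the integral of `u` against a symmetric
`α`-stable random measure with control measure `μ`. -/
noncomputable def stableExponent (α : ℝ) (μ : Measure E) (u : E → ℂ) (z : ℂ) : ℝ≥0∞ :=
  ∫⁻ e, ‖(z * u e).re‖ₑ ^ α ∂μ

/-- `X` has the law of the integral `∫ u dM` of `u ∈ L^α(μ)` against a symmetric `α`-stable random
measure `M` with control measure `μ`. The spectral measures of `X` are the case in which `u` is the
identity and `μ` a finite symmetric measure on the unit circle. -/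
structure IsStableIntegral (α : ℝ) (P : Measure Ω) (X : Ω → ℂ) (μ : Measure E) (u : E → ℂ) :
    Prop where
  measurable : Measurable u
  lintegral_lt_top : ∫⁻ e, ‖u e‖ₑ ^ α ∂μ < ⊤
  charFun_eq : ∀ z, complexCharFun P X z = Complex.exp (-((stableExponent α μ u z).toReal : ℂ))

theorem stableExponent_le (hα : 0 ≤ α) (u : E → ℂ) (z : ℂ) :
    stableExponent α μ u z ≤ ‖z‖ₑ ^ α * ∫⁻ e, ‖u e‖ₑ ^ α ∂μ := by
  rw [← lintegral_const_mul' _ _ (ENNReal.rpow_ne_top_of_nonneg hα enorm_ne_top)]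
  refine lintegral_mono fun e => ?_
  rw [← ENNReal.mul_rpow_of_nonneg _ _ hα, ← enorm_mul]
  exact ENNReal.rpow_le_rpow (enorm_re_le _) hα

theorem setLIntegral_ball_stableExponent [SFinite μ] (hα : 0 < α) (hu : Measurable u) :
    ∫⁻ z in Metric.ball (0 : ℂ) 1, stableExponent α μ u z
      = (∫⁻ e, ‖u e‖ₑ ^ α ∂μ) * discConst α := by
  simp only [stableExponent]
  rw [lintegral_lintegral_swap (by fun_prop)]
  simp only [setLIntegral_ball_enorm_re_mul hα]
  rw [lintegral_mul_const _ (by fun_prop)]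

theorem tendsto_stableExponent (hα : 1 ≤ α) {v : ℕ → E → ℂ} (hv : ∀ m, Measurable (v m))
    (hu : Measurable u) (h : Tendsto (fun m => ∫⁻ e, ‖v m e - u e‖ₑ ^ α ∂μ) atTop (𝓝 0)) (z : ℂ) :
    Tendsto (fun m => stableExponent α μ (v m) z) atTop (𝓝 (stableExponent α μ u z)) := by
  have hα0 : 0 ≤ α := by positivity
  refine tendsto_lintegral_enorm_rpow hα (v := fun m e => (z * v m e).re) (fun m => by fun_prop)
    (by fun_prop) ?_
  have hbound : Tendsto (fun m => ‖z‖ₑ ^ α * ∫⁻ e, ‖v m e - u e‖ₑ ^ α ∂μ) atTop (𝓝 0) := by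
    simpa using ENNReal.Tendsto.const_mul h
      (Or.inr (ENNReal.rpow_ne_top_of_nonneg hα0 (enorm_ne_top (x := z))))
  refine tendsto_of_tendsto_of_tendsto_of_le_of_le tendsto_const_nhds hbound
    (fun _ => zero_le) fun m => ?_
  simpa only [stableExponent, mul_sub, Complex.sub_re] using
    stableExponent_le (μ := μ) hα0 (fun e => v m e - u e) z

theorem stableExponent_ne_top (hα : 0 ≤ α) (hfin : ∫⁻ e, ‖u e‖ₑ ^ α ∂μ < ⊤) (z : ℂ) :
    stableExponent α μ u z ≠ ⊤ :=
  ((stableExponent_le hα u z).trans_lt (ENNReal.mul_lt_top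
    (ENNReal.rpow_ne_top_of_nonneg hα enorm_ne_top).lt_top hfin)).ne

theorem IsStableIntegral.stableExponent_eq (hα : 0 ≤ α) {F : Type*} [MeasurableSpace F]
    {ν : Measure F} {v : F → ℂ} (hu : IsStableIntegral α P X μ u)
    (hv : IsStableIntegral α P X ν v) : stableExponent α μ u = stableExponent α ν v := by
  funext z
  have hexp := (hu.charFun_eq z).symm.trans (hv.charFun_eq z)
  refine (ENNReal.toReal_eq_toReal_iff' (stableExponent_ne_top hα hu.lintegral_lt_top z)
    (stableExponent_ne_top hα hv.lintegral_lt_top z)).1 ?_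
  exact_mod_cast neg_injective (Real.exp_injective (by exact_mod_cast hexp))

theorem IsStableIntegral.lintegral_eq [SFinite μ] (hα : 0 < α) {F : Type*} [MeasurableSpace F]
    {ν : Measure F} [SFinite ν] {v : F → ℂ} (hu : IsStableIntegral α P X μ u)
    (hv : IsStableIntegral α P X ν v) : ∫⁻ e, ‖u e‖ₑ ^ α ∂μ = ∫⁻ e, ‖v e‖ₑ ^ α ∂ν := by
  refine (ENNReal.mul_left_inj (discConst_ne_zero hα) (discConst_ne_top hα.le)).1 ?_
  rw [← setLIntegral_ball_stableExponent hα hu.measurable,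
    ← setLIntegral_ball_stableExponent hα hv.measurable, hu.stableExponent_eq hα.le hv]

theorem IsSpectralMeasure.isStableIntegral (hα : 0 ≤ α) {Γ : Measure ℂ}
    (h : IsSpectralMeasure α P X Γ) : IsStableIntegral α P X Γ id where
  measurable := measurable_id
  lintegral_lt_top := by
    have := h.finite
    have hone : ∀ᵐ s ∂Γ, ‖id s‖ₑ ^ α = 1 := by
      filter_upwards [h.sphere] with s hs
      simp [← ofReal_norm, hs]
    rw [lintegral_congr_ae hone]
    simp
  charFun_eq z := by
    rw [complexCharFun, h.charFun_eq, stableExponent,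
      ← integral_norm_rpow_eq_toReal hα (by fun_prop)]
    rfl

/-- The image on the unit circle of `|s|^α dm(s)` under `s ↦ s / |s|`. It has the same
characteristic exponent as `m`; the point `0`, where the division gives `0`, carries no mass. -/
noncomputable def circleMeasure (α : ℝ) (m : Measure ℂ) : Measure ℂ :=
  (m.withDensity fun s => ‖s‖ₑ ^ α).map fun s => s / ‖s‖

theorem lintegral_circleMeasure (m : Measure ℂ) {F : ℂ → ℝ≥0∞} (hF : Measurable F) :
    ∫⁻ s, F s ∂circleMeasure α m = ∫⁻ s, ‖s‖ₑ ^ α * F (s / ‖s‖) ∂m := by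
  rw [circleMeasure, lintegral_map hF (by fun_prop),
    lintegral_withDensity_eq_lintegral_mul _ (by fun_prop) (by fun_prop)]
  rfl

theorem lintegral_circleMeasure_enorm_clm_rpow {V : Type*} [NormedAddCommGroup V]
    [NormedSpace ℝ V] (hα : 0 < α) (m : Measure ℂ) (L : ℂ →L[ℝ] V) :
    ∫⁻ s, ‖L s‖ₑ ^ α ∂circleMeasure α m = ∫⁻ s, ‖L s‖ₑ ^ α ∂m := by
  rw [lintegral_circleMeasure m (L.continuous.enorm.measurable.pow_const α)]
  refine lintegral_congr fun s => ?_
  rcases eq_or_ne s 0 with rfl | hs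
  · simp [hα]
  have hpolar : ‖s‖ • (s / ‖s‖ : ℂ) = s := by
    rw [Complex.real_smul, mul_div_cancel₀ _ (by simpa using hs)]
  rw [← ENNReal.mul_rpow_of_nonneg _ _ hα.le, ← enorm_norm s, ← enorm_smul, ← map_smul, hpolar]

theorem ae_norm_eq_one_circleMeasure (hα : 0 < α) (m : Measure ℂ) :
    ∀ᵐ s ∂circleMeasure α m, ‖s‖ = 1 := by
  rw [circleMeasure, ae_map_iff (by fun_prop) (measurableSet_eq_fun (by fun_prop) (by fun_prop)),
    ae_withDensity_iff (by fun_prop)]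
  refine ae_of_all _ fun s hs => ?_
  have hs0 : s ≠ 0 := by
    rintro rfl
    simp [hα] at hs
  simp [hs0]

theorem isNegInvariant_circleMeasure (m : Measure ℂ) [m.IsNegInvariant] :
    (circleMeasure α m).IsNegInvariant where
  neg_eq_self := by
    refine Measure.ext_of_lintegral _ fun F hF => ?_
    rw [Measure.neg, lintegral_map hF measurable_neg, lintegral_circleMeasure m hF,
      lintegral_circleMeasure m (F := fun s => F (-s)) (hF.comp measurable_neg)]
    conv_rhs => rw [← lintegral_neg_eq_self]
    simp [neg_div]

theorem IsStableIntegral.isSpectralMeasure_circleMeasure (hα : 0 < α)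
    (h : IsStableIntegral α P X μ u) [(μ.map u).IsNegInvariant] :
    IsSpectralMeasure α P X (circleMeasure α (μ.map u)) where
  finite := by
    have := isFiniteMeasure_withDensity (μ := μ.map u) (f := fun s => ‖s‖ₑ ^ α)
      (by rw [lintegral_map (by fun_prop) h.measurable]; exact h.lintegral_lt_top.ne)
    exact Measure.isFiniteMeasure_map _ _
  sphere := ae_norm_eq_one_circleMeasure hα _
  symm :=
    have := isNegInvariant_circleMeasure (α := α) (μ.map u)
    Measure.map_neg_eq_self _
  charFun_eq z := by
    refine (h.charFun_eq z).trans ?_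
    have hexp := lintegral_circleMeasure_enorm_clm_rpow hα (μ.map u)
      (Complex.reCLM ∘L ContinuousLinearMap.mul ℝ ℂ z)
    simp only [ContinuousLinearMap.comp_apply, ContinuousLinearMap.mul_apply',
      Complex.reCLM_apply] at hexp
    rw [lintegral_map (by fun_prop) h.measurable] at hexp
    rw [stableExponent, ← hexp, ← integral_norm_rpow_eq_toReal hα.le (by fun_prop)]
    rfl

theorem IsStableIntegral.stableNormPow_eq [SFinite μ] (hα : 0 < α)
    (h : IsStableIntegral α P X μ u) [(μ.map u).IsNegInvariant] :
    stableNormPow α P X = ∫⁻ e, ‖u e‖ₑ ^ α ∂μ := by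
  have hcircle := h.isSpectralMeasure_circleMeasure hα
  refine le_antisymm (iInf₂_le_of_le _ hcircle ?_) (le_iInf₂ fun Γ hΓ => ?_)
  · have := hcircle.finite
    simp only [ofReal_norm_rpow hα.le]
    exact ((hcircle.isStableIntegral hα.le).lintegral_eq hα h).le
  · have := hΓ.finite
    simp only [ofReal_norm_rpow hα.le]
    exact (h.lintegral_eq hα (hΓ.isStableIntegral hα.le)).le

theorem stableNormPow_zero [IsProbabilityMeasure P] : stableNormPow α P (fun _ => 0) = 0 := by
  have hzero : IsSpectralMeasure α P (fun _ => 0) 0 :=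
    { finite := inferInstance, sphere := by simp, symm := by simp, charFun_eq := by simp }
  exact le_antisymm ((iInf₂_le _ hzero).trans_eq (by simp)) zero_le

theorem ofReal_one_sub_complexCharFun_re_le [IsProbabilityMeasure P] (hα : 0 < α) (z : ℂ) :
    ENNReal.ofReal (1 - (complexCharFun P X z).re) ≤ ‖z‖ₑ ^ α * stableNormPow α P X := by
  rcases eq_or_ne z 0 with rfl | hz
  · simp [complexCharFun]
  rw [mul_comm, ← ENNReal.div_le_iff (by simp [hz, hα])
    (ENNReal.rpow_ne_top_of_nonneg hα.le enorm_ne_top)]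
  refine le_iInf₂ fun Γ hΓ => ENNReal.div_le_of_le_mul' ?_
  have hstable := hΓ.isStableIntegral hα.le
  simp only [ofReal_norm_rpow hα.le]
  refine le_trans ?_ (stableExponent_le hα.le id z)
  rw [hstable.charFun_eq, ← Complex.ofReal_neg, Complex.exp_ofReal_re,
    ENNReal.ofReal_le_iff_le_toReal (stableExponent_ne_top hα.le hstable.lintegral_lt_top z)]
  linarith [Real.add_one_le_exp (-(stableExponent α Γ id z).toReal)]

theorem norm_exp_I_mul_sub_one_sq (t : ℝ) :
    ‖Complex.exp (Complex.I * (t : ℂ)) - 1‖ ^ 2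
      = 2 * (1 - (Complex.exp (Complex.I * (t : ℂ))).re) := by
  have hnorm := Complex.norm_exp_I_mul_ofReal t
  rw [← Complex.normSq_eq_norm_sq, Complex.normSq_sub, Complex.normSq_eq_norm_sq, hnorm]
  simp only [map_one, mul_one]
  ring

theorem integrable_exp_I_mul [IsFiniteMeasure P] {s : Ω → ℝ} (hs : AEMeasurable s P) :
    Integrable (fun ω => Complex.exp (Complex.I * (s ω : ℂ))) P :=
  .of_bound (by fun_prop) 1 (ae_of_all _ fun ω => (Complex.norm_exp_I_mul_ofReal _).le)

theorem sq_integral_norm_le [IsProbabilityMeasure P] {V : Type*} [NormedAddCommGroup V]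
    {w : Ω → V} (hw : MemLp w 2 P) : (∫ ω, ‖w ω‖ ∂P) ^ 2 ≤ ∫ ω, ‖w ω‖ ^ 2 ∂P := by
  have hvar := variance_nonneg (fun ω => ‖w ω‖) P
  rwa [variance_eq_sub hw.norm, sub_nonneg] at hvar

theorem sq_norm_integral_exp_add_sub_le [IsProbabilityMeasure P] {s t : Ω → ℝ}
    (hs : AEMeasurable s P) (ht : AEMeasurable t P) :
    ‖∫ ω, Complex.exp (Complex.I * ((s ω + t ω : ℝ) : ℂ)) ∂P
        - ∫ ω, Complex.exp (Complex.I * (s ω : ℂ)) ∂P‖ ^ 2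
      ≤ 2 * (1 - (∫ ω, Complex.exp (Complex.I * (t ω : ℂ)) ∂P).re) := by
  have hint := integrable_exp_I_mul ht
  have hmem : MemLp (fun ω => Complex.exp (Complex.I * (t ω : ℂ)) - 1) 2 P :=
    .sub (.of_bound hint.1 1 (ae_of_all _ fun ω => (Complex.norm_exp_I_mul_ofReal _).le))
      (memLp_const 1)
  have hfactor (ω : Ω) : ‖Complex.exp (Complex.I * ((s ω + t ω : ℝ) : ℂ))
      - Complex.exp (Complex.I * (s ω : ℂ))‖ = ‖Complex.exp (Complex.I * (t ω : ℂ)) - 1‖ := by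
    rw [Complex.ofReal_add, mul_add, Complex.exp_add, ← mul_sub_one, norm_mul,
      Complex.norm_exp_I_mul_ofReal, one_mul]
  calc ‖∫ ω, Complex.exp (Complex.I * ((s ω + t ω : ℝ) : ℂ)) ∂P
        - ∫ ω, Complex.exp (Complex.I * (s ω : ℂ)) ∂P‖ ^ 2
      ≤ (∫ ω, ‖Complex.exp (Complex.I * (t ω : ℂ)) - 1‖ ∂P) ^ 2 := by
        rw [← integral_sub (integrable_exp_I_mul (s := fun ω => s ω + t ω) (hs.add ht))
          (integrable_exp_I_mul hs)]
        simp only [← hfactor]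
        gcongr
        exact norm_integral_le_integral_norm _
    _ ≤ ∫ ω, ‖Complex.exp (Complex.I * (t ω : ℂ)) - 1‖ ^ 2 ∂P := sq_integral_norm_le hmem
    _ = 2 * (1 - (∫ ω, Complex.exp (Complex.I * (t ω : ℂ)) ∂P).re) := by
        have hintre : Integrable (fun ω => (Complex.exp (Complex.I * (t ω : ℂ))).re) P := hint.re
        have hre : ∫ ω, (Complex.exp (Complex.I * (t ω : ℂ))).re ∂P = _ := integral_re hint
        simp only [norm_exp_I_mul_sub_one_sq]
        rw [integral_const_mul, integral_sub (integrable_const _) hintre, integral_const,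
          probReal_univ, one_smul]
        exact congrArg (fun r => 2 * (1 - r)) hre

theorem tendsto_complexCharFun [IsProbabilityMeasure P] (hα : 0 < α) {X : ℕ → Ω → ℂ}
    (hX : ∀ m, AEMeasurable (X m) P) (hY : AEMeasurable Y P)
    (h : Tendsto (fun m => stableNormPow α P (fun ω => Y ω - X m ω)) atTop (𝓝 0)) (z : ℂ) :
    Tendsto (fun m => complexCharFun P (X m) z) atTop (𝓝 (complexCharFun P Y z)) := by
  have hz : ‖z‖ₑ ^ α ≠ ⊤ := ENNReal.rpow_ne_top_of_nonneg hα.le enorm_ne_top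
  have hbound : Tendsto (fun m => 2 * (‖z‖ₑ ^ α * stableNormPow α P (fun ω => Y ω - X m ω)))
      atTop (𝓝 0) := by
    simpa using ENNReal.Tendsto.const_mul (ENNReal.Tendsto.const_mul h (Or.inr hz))
      (Or.inr ENNReal.ofNat_ne_top)
  have hdist (m : ℕ) : ‖complexCharFun P Y z - complexCharFun P (X m) z‖ₑ ^ 2
      ≤ 2 * (‖z‖ₑ ^ α * stableNormPow α P (fun ω => Y ω - X m ω)) := by
    have hsq := sq_norm_integral_exp_add_sub_le (P := P) (s := fun ω => (z * X m ω).re)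
      (t := fun ω => (z * (Y ω - X m ω)).re) (by fun_prop) (by fun_prop)
    simp only [← Complex.add_re, ← mul_add, add_sub_cancel] at hsq
    rw [← ofReal_norm, ← ENNReal.ofReal_pow (norm_nonneg _)]
    refine (ENNReal.ofReal_le_ofReal hsq).trans ?_
    rw [ENNReal.ofReal_mul zero_le_two, ENNReal.ofReal_ofNat]
    gcongr
    exact ofReal_one_sub_complexCharFun_re_le hα z
  have hsq : Tendsto (fun m => ‖complexCharFun P Y z - complexCharFun P (X m) z‖ₑ ^ 2) atTop
      (𝓝 0) :=
    tendsto_of_tendsto_of_tendsto_of_le_of_le tendsto_const_nhds hbound (fun _ => zero_le) hdist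
  rw [tendsto_iff_edist_tendsto_0]
  have hroot := hsq.ennrpow_const (1 / 2)
  rw [ENNReal.zero_rpow_of_pos (by norm_num)] at hroot
  refine hroot.congr fun m => ?_
  rw [edist_comm, edist_eq_enorm_sub, ← ENNReal.rpow_natCast, ← ENNReal.rpow_mul]
  norm_num

theorem IsStableIntegral.of_tendsto [IsProbabilityMeasure P] (hα : 1 ≤ α) {X : ℕ → Ω → ℂ}
    {v : ℕ → E → ℂ} (h : ∀ m, IsStableIntegral α P (X m) μ (v m))
    (hX : ∀ m, AEMeasurable (X m) P) (hY : AEMeasurable Y P) (hu : Measurable u)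
    (hXY : Tendsto (fun m => stableNormPow α P (fun ω => Y ω - X m ω)) atTop (𝓝 0))
    (hvu : Tendsto (fun m => ∫⁻ e, ‖v m e - u e‖ₑ ^ α ∂μ) atTop (𝓝 0)) :
    IsStableIntegral α P Y μ u := by
  have hα0 : 0 < α := by positivity
  have hfin : ∫⁻ e, ‖u e‖ₑ ^ α ∂μ < ⊤ := lintegral_enorm_rpow_lt_top_of_tendsto hα
    (fun m => (h m).measurable.aestronglyMeasurable) (fun m => (h m).lintegral_lt_top) hvu
  refine ⟨hu, hfin, fun z => ?_⟩
  have hexp := (ENNReal.tendsto_toReal (stableExponent_ne_top hα0.le hfin z)).comp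
    (tendsto_stableExponent hα (fun m => (h m).measurable) hu hvu z)
  have hlim : Tendsto (fun m => Complex.exp (-((stableExponent α μ (v m) z).toReal : ℂ))) atTop
      (𝓝 (Complex.exp (-((stableExponent α μ u z).toReal : ℂ)))) :=
    (Complex.continuous_exp.tendsto _).comp ((Complex.continuous_ofReal.tendsto _).comp hexp).neg
  refine tendsto_nhds_unique (tendsto_complexCharFun hα0 hX hY hXY z) (hlim.congr fun m => ?_)
  exact ((h m).charFun_eq z).symm

end StableIntegral

/-- The disjoint union of two measures: the control measure of a pair of independent random
measures. -/
noncomputable def sumMeasure {E F : Type*} [MeasurableSpace E] [MeasurableSpace F] (μ : Measure E)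
    (ν : Measure F) : Measure (E ⊕ F) :=
  μ.map Sum.inl + ν.map Sum.inr

section SumMeasure

variable {E F : Type*} [MeasurableSpace E] [MeasurableSpace F] {μ : Measure E} {ν : Measure F}

instance [IsFiniteMeasure μ] [IsFiniteMeasure ν] : IsFiniteMeasure (sumMeasure μ ν) := by
  unfold sumMeasure
  infer_instance

theorem lintegral_sumMeasure {H : E ⊕ F → ℝ≥0∞} (hH : Measurable H) :
    ∫⁻ p, H p ∂sumMeasure μ ν = ∫⁻ e, H (Sum.inl e) ∂μ + ∫⁻ e, H (Sum.inr e) ∂ν := by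
  rw [sumMeasure, lintegral_add_measure, lintegral_map hH measurable_inl,
    lintegral_map hH measurable_inr]

theorem map_sumMeasure_sumElim {G : Type*} [MeasurableSpace G] {u : E → G} {v : F → G}
    (hu : Measurable u) (hv : Measurable v) :
    (sumMeasure μ ν).map (Sum.elim u v) = μ.map u + ν.map v := by
  rw [sumMeasure, Measure.map_add _ _ (hu.sumElim hv),
    Measure.map_map (hu.sumElim hv) measurable_inl,
    Measure.map_map (hu.sumElim hv) measurable_inr, Sum.elim_comp_inl, Sum.elim_comp_inr]

theorem isNegInvariant_map_sumMeasure {G : Type*} [MeasurableSpace G] [Neg G] [MeasurableNeg G]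
    {u : E → G} {v : F → G} (hu : Measurable u) (hv : Measurable v)
    [(μ.map u).IsNegInvariant] [(ν.map v).IsNegInvariant] :
    ((sumMeasure μ ν).map (Sum.elim u v)).IsNegInvariant where
  neg_eq_self := by
    rw [map_sumMeasure_sumElim hu hv, Measure.neg, Measure.map_add _ _ measurable_neg,
      Measure.map_neg_eq_self, Measure.map_neg_eq_self]

theorem complexCharFun_add_of_indepFun {Ω : Type*} [MeasurableSpace Ω] {P : Measure Ω}
    {X Y : Ω → ℂ} (hXY : IndepFun X Y P) (hX : AEMeasurable X P) (hY : AEMeasurable Y P) (z : ℂ) :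
    complexCharFun P (X + Y) z = complexCharFun P X z * complexCharFun P Y z := by
  have hexp : Measurable fun w : ℂ => Complex.exp (Complex.I * ((z * w).re : ℂ)) := by fun_prop
  refine Eq.trans ?_ ((hXY.comp hexp hexp).integral_fun_mul_eq_mul_integral
    (hexp.comp_aemeasurable hX).aestronglyMeasurable
    (hexp.comp_aemeasurable hY).aestronglyMeasurable)
  simp only [complexCharFun, Function.comp_apply, Pi.add_apply, mul_add, Complex.add_re,
    Complex.ofReal_add, Complex.exp_add]

theorem IsStableIntegral.add_of_indepFun {Ω : Type*} [MeasurableSpace Ω] {P : Measure Ω}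
    {X Y : Ω → ℂ} {α : ℝ} (hα : 0 ≤ α) {u : E → ℂ} {v : F → ℂ} (hu : IsStableIntegral α P X μ u)
    (hv : IsStableIntegral α P Y ν v) (hXY : IndepFun X Y P) (hX : AEMeasurable X P)
    (hY : AEMeasurable Y P) :
    IsStableIntegral α P (X + Y) (sumMeasure μ ν) (Sum.elim u v) where
  measurable := hu.measurable.sumElim hv.measurable
  lintegral_lt_top := by
    rw [lintegral_sumMeasure ((hu.measurable.sumElim hv.measurable).enorm.pow_const α)]
    exact ENNReal.add_lt_top.2 ⟨hu.lintegral_lt_top, hv.lintegral_lt_top⟩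
  charFun_eq z := by
    have huv := hu.measurable.sumElim hv.measurable
    have hexp : stableExponent α (sumMeasure μ ν) (Sum.elim u v) z
        = stableExponent α μ u z + stableExponent α ν v z := lintegral_sumMeasure (by fun_prop)
    rw [complexCharFun_add_of_indepFun hXY hX hY, hu.charFun_eq, hv.charFun_eq, ← Complex.exp_add,
      hexp, ENNReal.toReal_add (stableExponent_ne_top hα hu.lintegral_lt_top z)
      (stableExponent_ne_top hα hv.lintegral_lt_top z), Complex.ofReal_add, neg_add]

end SumMeasure

/-! ### Spectral densities -/

section Density

variable {T : ℕ} {α : ℝ} {Γ : Measure (ℝ × (Fin T → ℂ))} {f : ℝ → Matrix (Fin T) (Fin T) ℂ}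
  {x : ℝ → Fin T → ℂ}

theorem spow_smul_of_pos {c : ℝ} (hc : 0 < c) (β : ℝ) (z : ℂ) :
    spow β (c • z) = c ^ β • spow β z := by
  have hpow : c ^ (β - 1) * c = c ^ β := by rw [← Real.rpow_add_one hc.ne', sub_add_cancel]
  rw [spow, norm_smul, Real.norm_of_nonneg hc.le, Real.mul_rpow hc.le (norm_nonneg z), spow, ← hpow]
  simp only [Complex.real_smul, map_mul, Complex.conj_ofReal, Complex.ofReal_mul]
  ring

theorem mul_spow_self (hα : α ≠ 0) (z : ℂ) : z * spow (α - 1) z = ((‖z‖ ^ α : ℝ) : ℂ) := by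
  rcases eq_or_ne z 0 with rfl | hz
  · simp [hα]
  · have hpow : ‖z‖ ^ (α - 1 - 1) * ‖z‖ ^ 2 = ‖z‖ ^ α := by
      rw [← Real.rpow_add_natCast (norm_ne_zero_iff.2 hz)]
      congr 1
      push_cast
      ring
    rw [spow, mul_left_comm, Complex.mul_conj, Complex.normSq_eq_norm_sq, ← Complex.ofReal_mul,
      hpow]

@[fun_prop]
theorem measurable_spow (β : ℝ) : Measurable (spow β) := by
  unfold spow
  fun_prop

theorem norm_spow {β : ℝ} (hβ : β ≠ 0) (z : ℂ) : ‖spow β z‖ = ‖z‖ ^ β := by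
  rcases eq_or_ne z 0 with rfl | hz
  · simp [spow, hβ]
  · rw [spow, norm_mul, Complex.norm_real, RCLike.norm_conj, Real.norm_of_nonneg (by positivity),
      ← Real.rpow_add_one (norm_ne_zero_iff.2 hz), sub_add_cancel]

theorem covForm_add (M M' : Matrix (Fin T) (Fin T) ℂ) (v w : Fin T → ℂ) :
    covForm α (M + M') v w = covForm α M v w + covForm α M' v w := by
  simp only [covForm, Matrix.add_mulVec, dotProduct_add]

theorem covForm_eq_sum (M : Matrix (Fin T) (Fin T) ℂ) (v w : Fin T → ℂ) :
    covForm α M v w = ∑ k, ∑ l, M k l * (v k * spow (α - 1) (w l)) := by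
  simp only [covForm, dotProduct, Matrix.mulVec, Finset.mul_sum, mul_left_comm]

theorem covForm_smul_smul_of_pos {c : ℝ} (hc : 0 < c) (M : Matrix (Fin T) (Fin T) ℂ)
    (v w : Fin T → ℂ) : covForm α M (c • v) (c • w) = c ^ α • covForm α M v w := by
  have hpow : c * c ^ (α - 1) = c ^ α := by
    rw [mul_comm, ← Real.rpow_add_one hc.ne', sub_add_cancel]
  have hspow : (fun k => spow (α - 1) ((c • w) k)) = c ^ (α - 1) • fun k => spow (α - 1) (w k) :=
    funext fun k => spow_smul_of_pos hc _ _
  rw [covForm, hspow, Matrix.mulVec_smul, smul_dotProduct, dotProduct_smul, smul_smul, hpow,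
    covForm]

theorem covForm_indicator_left (S : Set ℝ) (x y : ℝ → Fin T → ℂ) (θ : ℝ) :
    covForm α (f θ) (S.indicator x θ) (y θ)
      = S.indicator (fun θ => covForm α (f θ) (x θ) (y θ)) θ := by
  by_cases hθ : θ ∈ S <;> simp [hθ, covForm]

@[fun_prop]
theorem measurable_dotProduct_snd (hx : Measurable x) :
    Measurable fun p : ℝ × (Fin T → ℂ) => x p.1 ⬝ᵥ p.2 := by
  unfold dotProduct
  fun_prop

theorem exists_measurable_bounded_smul {E V : Type*} [MeasurableSpace E] [NormedAddCommGroup V]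
    [NormedSpace ℝ V] [MeasurableSpace V] [OpensMeasurableSpace V] [MeasurableSMul₂ ℝ V] {x : E → V}
    (hx : Measurable x) :
    ∃ r : E → ℝ, ∃ y : E → V, Measurable r ∧ Measurable y ∧ (∀ e, 0 < r e) ∧
      (∀ e, ‖y e‖ ≤ 1) ∧ ∀ e, x e = r e • y e := by
  have hr (e : E) : 0 < max 1 ‖x e‖ := lt_max_of_lt_left one_pos
  refine ⟨fun e => max 1 ‖x e‖, fun e => (max 1 ‖x e‖)⁻¹ • x e, by fun_prop, by fun_prop, hr,
    fun e => ?_, fun e => (smul_inv_smul₀ (hr e).ne' _).symm⟩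
  rw [norm_smul, norm_inv, Real.norm_of_nonneg (hr e).le]
  exact inv_mul_le_one_of_le₀ (le_max_right _ _) (hr e).le

namespace IsDensityOf

theorem aestronglyMeasurable_covForm (h : IsDensityOf α Γ f) (hx : Measurable x) :
    AEStronglyMeasurable (fun θ => covForm α (f θ) (x θ) (x θ))
      (volume.restrict (Set.Icc (-Real.pi) Real.pi)) := by
  simp only [covForm_eq_sum]
  refine Finset.aestronglyMeasurable_fun_sum _ fun k _ =>
    Finset.aestronglyMeasurable_fun_sum _ fun l _ => (h.integrable k l).1.mul ?_
  exact Measurable.aestronglyMeasurable (by fun_prop)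

theorem integrableOn_covForm (hα : 1 < α) (h : IsDensityOf α Γ f) (hx : Measurable x) {C : ℝ}
    (hC : ∀ θ k, ‖x θ k‖ ≤ C) :
    IntegrableOn (fun θ => covForm α (f θ) (x θ) (x θ)) (Set.Icc (-Real.pi) Real.pi) := by
  simp only [covForm_eq_sum]
  refine integrable_finsetSum _ fun k _ => integrable_finsetSum _ fun l _ =>
    (h.integrable k l).mul_bdd (c := C * C ^ (α - 1)) ?_ (ae_of_all _ fun θ => ?_)
  · exact Measurable.aestronglyMeasurable (by fun_prop)
  · have hC0 : 0 ≤ C := (norm_nonneg _).trans (hC θ k)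
    have hα1 : 0 < α - 1 := sub_pos.2 hα
    rw [norm_mul, norm_spow hα1.ne']
    gcongr <;> exact hC θ _

theorem norm_dotProduct_le (h : IsDensityOf α Γ f) {C : ℝ} (hC : ∀ θ k, ‖x θ k‖ ≤ C) :
    ∀ᵐ p ∂Γ, ‖x p.1 ⬝ᵥ p.2‖ ≤ T * C := by
  filter_upwards [h.sphere] with p hp
  have hle (k : Fin T) : ‖p.2 k‖ ≤ 1 := by
    refine (sq_le_one_iff₀ (norm_nonneg _)).1 (hp.2 ▸ ?_)
    exact Finset.single_le_sum (f := fun k => ‖p.2 k‖ ^ 2) (fun i _ => by positivity)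
      (Finset.mem_univ k)
  calc ‖x p.1 ⬝ᵥ p.2‖ ≤ ∑ k, ‖x p.1 k * p.2 k‖ := norm_sum_le _ _
    _ ≤ ∑ _k : Fin T, C := Finset.sum_le_sum fun k _ => by
        rw [norm_mul]
        exact (mul_le_of_le_one_right (norm_nonneg _) (hle k)).trans (hC _ k)
    _ = T * C := by simp

theorem integrable_norm_dotProduct_rpow (hα : 0 ≤ α) (h : IsDensityOf α Γ f) (hx : Measurable x)
    {C : ℝ} (hC : ∀ θ k, ‖x θ k‖ ≤ C) : Integrable (fun p => ‖x p.1 ⬝ᵥ p.2‖ ^ α) Γ := by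
  have := h.finite
  refine .of_bound (C := (T * C) ^ α) (by fun_prop) ?_
  filter_upwards [h.norm_dotProduct_le hC] with p hp
  rw [Real.norm_of_nonneg (by positivity)]
  gcongr

theorem setIntegral_covForm_re (hα : 1 < α) (h : IsDensityOf α Γ f) (hx : Measurable x) {C : ℝ}
    (hC : ∀ θ k, ‖x θ k‖ ≤ C) {S : Set ℝ} (hS : MeasurableSet S) :
    ∫ θ in S, (covForm α (f θ) (x θ) (x θ)).re ∂(volume.restrict (Set.Icc (-Real.pi) Real.pi))
      = ∫ p in Prod.fst ⁻¹' S, ‖x p.1 ⬝ᵥ p.2‖ ^ α ∂Γ := by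
  have hC' (θ : ℝ) (k : Fin T) : ‖S.indicator x θ k‖ ≤ C := by
    by_cases hθ : θ ∈ S
    · simpa [hθ] using hC θ k
    · simpa [hθ] using (norm_nonneg _).trans (hC θ k)
  have hdot (p : ℝ × (Fin T → ℂ)) : (S.indicator x p.1 ⬝ᵥ p.2) * spow (α - 1) (x p.1 ⬝ᵥ p.2)
      = (Prod.fst ⁻¹' S).indicator (fun p => ((‖x p.1 ⬝ᵥ p.2‖ ^ α : ℝ) : ℂ)) p := by
    by_cases hp : p.1 ∈ S
    · simp [hp, ← mul_spow_self (zero_lt_one.trans hα).ne']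
    · simp [hp]
  have hcov := h.covariation _ _ (hx.indicator hS) hx ⟨C, hC'⟩ ⟨C, hC⟩
  simp only [hdot, covForm_indicator_left] at hcov
  rw [integral_indicator (measurable_fst hS), integral_complex_ofReal,
    integral_indicator hS] at hcov
  have hint := (h.integrableOn_covForm hα hx hC).integrable.restrict (s := S)
  have hre : ∫ θ in S, (covForm α (f θ) (x θ) (x θ)).re
      ∂(volume.restrict (Set.Icc (-Real.pi) Real.pi)) = _ := integral_re hint
  rw [hre, ← Complex.ofReal_re (∫ p in Prod.fst ⁻¹' S, _ ∂Γ), hcov]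
  rfl

theorem covForm_re_nonneg_of_bounded (hα : 1 < α) (h : IsDensityOf α Γ f) (hx : Measurable x)
    {C : ℝ} (hC : ∀ θ k, ‖x θ k‖ ≤ C) :
    ∀ᵐ θ ∂(volume.restrict (Set.Icc (-Real.pi) Real.pi)),
      0 ≤ (covForm α (f θ) (x θ) (x θ)).re := by
  refine ae_nonneg_of_forall_setIntegral_nonneg (h.integrableOn_covForm hα hx hC).re
    fun S hS _ => ?_
  exact (integral_nonneg fun p => by positivity).trans_eq
    (h.setIntegral_covForm_re hα hx hC hS).symm

theorem withDensity_covForm_of_bounded (hα : 1 < α) (h : IsDensityOf α Γ f) (hx : Measurable x)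
    {C : ℝ} (hC : ∀ θ k, ‖x θ k‖ ≤ C) :
    (volume.restrict (Set.Icc (-Real.pi) Real.pi)).withDensity
        (fun θ => ENNReal.ofReal (covForm α (f θ) (x θ) (x θ)).re)
      = (Γ.withDensity fun p => ‖x p.1 ⬝ᵥ p.2‖ₑ ^ α).map Prod.fst := by
  have hα0 : 0 ≤ α := zero_le_one.trans hα.le
  have hint : Integrable (fun θ => (covForm α (f θ) (x θ) (x θ)).re)
    (volume.restrict (Set.Icc (-Real.pi) Real.pi)) := (h.integrableOn_covForm hα hx hC).re
  ext S hS
  rw [withDensity_apply _ hS, Measure.map_apply measurable_fst hS,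
    withDensity_apply _ (measurable_fst hS), ← ofReal_integral_eq_lintegral_ofReal hint.restrict
      (ae_restrict_of_ae (h.covForm_re_nonneg_of_bounded hα hx hC)),
    h.setIntegral_covForm_re hα hx hC hS, ofReal_integral_eq_lintegral_ofReal
      (h.integrable_norm_dotProduct_rpow hα0 hx hC).restrict (ae_of_all _ fun p => by positivity)]
  simp only [ofReal_norm_rpow hα0]

theorem covForm_re_nonneg (hα : 1 < α) (h : IsDensityOf α Γ f) (hx : Measurable x) :
    ∀ᵐ θ ∂(volume.restrict (Set.Icc (-Real.pi) Real.pi)),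
      0 ≤ (covForm α (f θ) (x θ) (x θ)).re := by
  obtain ⟨r, y, -, hy, hr, hnorm, hxy⟩ := exists_measurable_bounded_smul hx
  have hbound (θ : ℝ) (k : Fin T) : ‖y θ k‖ ≤ 1 := (norm_le_pi_norm _ k).trans (hnorm θ)
  filter_upwards [h.covForm_re_nonneg_of_bounded hα hy hbound] with θ hθ
  rw [hxy, covForm_smul_smul_of_pos (hr θ), Complex.smul_re]
  exact mul_nonneg (Real.rpow_nonneg (hr θ).le α) hθ

theorem aemeasurable_covForm_re (h : IsDensityOf α Γ f) (hx : Measurable x) :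
    AEMeasurable (fun θ => ENNReal.ofReal (covForm α (f θ) (x θ) (x θ)).re)
      (volume.restrict (Set.Icc (-Real.pi) Real.pi)) :=
  (Complex.measurable_re.comp_aemeasurable
    (h.aestronglyMeasurable_covForm hx).aemeasurable).ennreal_ofReal

theorem normPow_eq (hα : 1 < α) (h : IsDensityOf α Γ f) (hx : Measurable x) :
    normPow α f x = ∫⁻ p, ‖x p.1 ⬝ᵥ p.2‖ₑ ^ α ∂Γ := by
  have hα0 : 0 ≤ α := zero_le_one.trans hα.le
  obtain ⟨r, y, hrm, hy, hr, hnorm, hxy⟩ := exists_measurable_bounded_smul hx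
  have hbound (θ : ℝ) (k : Fin T) : ‖y θ k‖ ≤ 1 := (norm_le_pi_norm _ k).trans (hnorm θ)
  have hrpow : Measurable fun θ => ENNReal.ofReal (r θ ^ α) := by fun_prop
  have hcov (θ : ℝ) : ENNReal.ofReal (covForm α (f θ) (x θ) (x θ)).re
      = ENNReal.ofReal (covForm α (f θ) (y θ) (y θ)).re * ENNReal.ofReal (r θ ^ α) := by
    rw [hxy, covForm_smul_smul_of_pos (hr θ), Complex.smul_re, smul_eq_mul,
      ENNReal.ofReal_mul (Real.rpow_nonneg (hr θ).le α), mul_comm]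
  have hdot (p : ℝ × (Fin T → ℂ)) : ‖x p.1 ⬝ᵥ p.2‖ₑ ^ α
      = ‖y p.1 ⬝ᵥ p.2‖ₑ ^ α * ENNReal.ofReal (r p.1 ^ α) := by
    rw [hxy, smul_dotProduct, enorm_smul, ENNReal.mul_rpow_of_nonneg _ _ hα0, mul_comm,
      ← ofReal_norm_rpow hα0 (r p.1), Real.norm_of_nonneg (hr _).le]
  calc normPow α f x
      = ∫⁻ θ, ENNReal.ofReal (r θ ^ α) ∂(volume.restrict (Set.Icc (-Real.pi) Real.pi)).withDensity
          (fun θ => ENNReal.ofReal (covForm α (f θ) (y θ) (y θ)).re) := by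
        rw [lintegral_withDensity_eq_lintegral_mul₀ (h.aemeasurable_covForm_re hy)
          hrpow.aemeasurable]
        exact lintegral_congr hcov
    _ = ∫⁻ p, ‖x p.1 ⬝ᵥ p.2‖ₑ ^ α ∂Γ := by
        rw [h.withDensity_covForm_of_bounded hα hy hbound, lintegral_map hrpow measurable_fst,
          lintegral_withDensity_eq_lintegral_mul _ (by fun_prop) (by fun_prop)]
        exact lintegral_congr fun p => (hdot p).symm

theorem normPow_add (hα : 1 < α) {Γ' : Measure (ℝ × (Fin T → ℂ))}
    {g : ℝ → Matrix (Fin T) (Fin T) ℂ} (hf : IsDensityOf α Γ f) (hg : IsDensityOf α Γ' g)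
    (hx : Measurable x) : normPow α (f + g) x = normPow α f x + normPow α g x := by
  rw [normPow, normPow, normPow, ← lintegral_add_left' (hf.aemeasurable_covForm_re hx)]
  refine lintegral_congr_ae ?_
  filter_upwards [hf.covForm_re_nonneg hα hx, hg.covForm_re_nonneg hα hx] with θ hfθ hgθ
  rw [Pi.add_apply, covForm_add, Complex.add_re, ENNReal.ofReal_add hfθ hgθ]

theorem isNegInvariant_map_dotProduct (h : IsDensityOf α Γ f) (hx : Measurable x) :
    (Γ.map fun p => x p.1 ⬝ᵥ p.2).IsNegInvariant where
  neg_eq_self := by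
    conv_rhs => rw [← h.symm]
    rw [Measure.neg, Measure.map_map measurable_neg (by fun_prop),
      Measure.map_map (by fun_prop) (by fun_prop)]
    simp only [Function.comp_def, dotProduct_neg]

end IsDensityOf

end Density

/-! ### Trigonometric polynomials -/

section TrigPoly

variable {Ω : Type*} {T : ℕ}

theorem isLinearMap_trigPoly (θ : ℝ) :
    IsLinearMap ℂ fun c : ℤ →₀ (Fin T → ℂ) => trigPoly c θ :=
  (Finsupp.lsum ℂ fun j : ℤ => LinearMap.lsmul ℂ (Fin T → ℂ)
    (Complex.exp (Complex.I * ((j * θ : ℝ) : ℂ)))).isLinear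

theorem isLinearMap_linComb (ζ : ℤ → Ω → Fin T → ℂ) (ω : Ω) :
    IsLinearMap ℂ fun c => linComb c ζ ω :=
  (Finsupp.lsum ℂ fun j => (dotProductBilin ℂ ℂ).flip (ζ j ω)).isLinear

theorem linComb_add_right (c : ℤ →₀ (Fin T → ℂ)) (ξ η : ℤ → Ω → Fin T → ℂ) (ω : Ω) :
    linComb c (ξ + η) ω = linComb c ξ ω + linComb c η ω := by
  simp only [linComb, Pi.add_apply, dotProduct_add, Finset.sum_add_distrib]

/-- The coefficients of `A_N`, as those of a trigonometric polynomial. -/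
noncomputable def symbolCoeff (N : ℕ) (a : ℕ → Fin T → ℂ) : ℤ →₀ (Fin T → ℂ) :=
  ∑ j ∈ Finset.range (N + 1), Finsupp.single (j : ℤ) (a j)

theorem linComb_symbolCoeff (N : ℕ) (a : ℕ → Fin T → ℂ) (ξ : ℤ → Ω → Fin T → ℂ) (ω : Ω) :
    linComb (symbolCoeff N a) ξ ω = functionalA N a ξ ω := by
  refine (map_sum (isLinearMap_linComb ξ ω).mk' _ _).trans (Finset.sum_congr rfl fun j _ => ?_)
  exact Finsupp.sum_single_index (h := fun j v => v ⬝ᵥ ξ j ω) (zero_dotProduct _)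

theorem trigPoly_symbolCoeff (N : ℕ) (a : ℕ → Fin T → ℂ) (θ : ℝ) :
    trigPoly (symbolCoeff N a) θ = symbolA N a θ := by
  refine (map_sum (isLinearMap_trigPoly θ).mk' _ _).trans (Finset.sum_congr rfl fun j _ => ?_)
  exact Finsupp.sum_single_index
    (h := fun (j : ℤ) v => Complex.exp (Complex.I * ((j * θ : ℝ) : ℂ)) • v) (smul_zero _)

@[fun_prop]
theorem measurable_trigPoly (c : ℤ →₀ (Fin T → ℂ)) : Measurable (trigPoly c) := by
  unfold trigPoly
  fun_prop

@[fun_prop]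
theorem measurable_symbolA (N : ℕ) (a : ℕ → Fin T → ℂ) : Measurable (symbolA N a) := by
  unfold symbolA
  fun_prop

theorem norm_trigPoly_le (c : ℤ →₀ (Fin T → ℂ)) (θ : ℝ) :
    ‖trigPoly c θ‖ ≤ ∑ j ∈ c.support, ‖c j‖ := by
  refine (norm_sum_le _ _).trans_eq (Finset.sum_congr rfl fun j _ => ?_)
  rw [norm_smul, Complex.norm_exp_I_mul_ofReal, one_mul]

variable [MeasurableSpace Ω] {ζ : ℤ → Ω → Fin T → ℂ}

theorem measurable_linComb (hζ : ∀ n, Measurable (ζ n)) (c : ℤ →₀ (Fin T → ℂ)) :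
    Measurable (linComb c ζ) := by
  unfold linComb dotProduct
  fun_prop

theorem measurable_functionalA (hζ : ∀ n, Measurable (ζ n)) (N : ℕ) (a : ℕ → Fin T → ℂ) :
    Measurable (functionalA N a ζ) := by
  unfold functionalA dotProduct
  fun_prop

end TrigPoly

theorem IsHarmonizable.exists_isStableIntegral {Ω : Type*} [MeasurableSpace Ω] {T : ℕ} {α : ℝ}
    {P : Measure Ω} {ξ : ℤ → Ω → Fin T → ℂ} {f : ℝ → Matrix (Fin T) (Fin T) ℂ} (hα : 0 ≤ α)
    (h : IsHarmonizable α P ξ f) :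
    ∃ Γ, IsDensityOf α Γ f ∧
      ∀ c, IsStableIntegral α P (linComb c ξ) Γ fun p => trigPoly c p.1 ⬝ᵥ p.2 := by
  obtain ⟨-, Γ, hΓ, hchar⟩ := h
  refine ⟨Γ, hΓ, fun c => ⟨by fun_prop, ?_, fun z => ?_⟩⟩
  · simp only [← ofReal_norm_rpow hα]
    exact (hΓ.integrable_norm_dotProduct_rpow hα (measurable_trigPoly c) fun θ k =>
      (norm_le_pi_norm _ k).trans (norm_trigPoly_le c θ)).lintegral_lt_top
  · have hlin (ω : Ω) : z * linComb c ξ ω = linComb (z • c) ξ ω :=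
      ((isLinearMap_linComb ξ ω).map_smul z c).symm
    have htrig (p : ℝ × (Fin T → ℂ)) :
        z * (trigPoly c p.1 ⬝ᵥ p.2) = trigPoly (z • c) p.1 ⬝ᵥ p.2 := by
      rw [(isLinearMap_trigPoly p.1).map_smul, smul_dotProduct, smul_eq_mul]
    simp only [complexCharFun, stableExponent, hlin, htrig, hchar]
    rw [← integral_norm_rpow_eq_toReal hα (by fun_prop)]
    rfl

/-! ### The error of a spectral characteristic -/

section Error

variable {Ω : Type*} [MeasurableSpace Ω] {T N : ℕ} {α : ℝ} {P : Measure Ω} {a : ℕ → Fin T → ℂ}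
  {ξ η : ℤ → Ω → Fin T → ℂ} {f g : ℝ → Matrix (Fin T) (Fin T) ℂ}
  {Γ Γ' : Measure (ℝ × (Fin T → ℂ))} {h h' : ℝ → Fin T → ℂ}

/-- The integrand that represents the error `A_N ξ - ∫ hᵀ (dZ^ξ + dZ^η)`, which is
`∫ (A_N - h)ᵀ dZ^ξ - ∫ hᵀ dZ^η`, as an integral over the disjoint union of the spectral measures of
`Z^ξ` and `Z^η`. -/
noncomputable def errorIntegrand (N : ℕ) (a : ℕ → Fin T → ℂ) (h : ℝ → Fin T → ℂ) :
    (ℝ × (Fin T → ℂ)) ⊕ (ℝ × (Fin T → ℂ)) → ℂ :=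
  Sum.elim (fun p => (symbolA N a p.1 - h p.1) ⬝ᵥ p.2) fun p => -h p.1 ⬝ᵥ p.2

@[fun_prop]
theorem measurable_errorIntegrand (hh : Measurable h) : Measurable (errorIntegrand N a h) :=
  .sumElim (measurable_dotProduct_snd (x := fun θ => symbolA N a θ - h θ) (by fun_prop))
    (measurable_dotProduct_snd hh.neg)

theorem lintegral_errorIntegrand (hα : 1 < α) (hf : IsDensityOf α Γ f) (hg : IsDensityOf α Γ' g)
    (hh : Measurable h) :
    ∫⁻ p, ‖errorIntegrand N a h p‖ₑ ^ α ∂sumMeasure Γ Γ' = estError α N a h f g := by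
  rw [lintegral_sumMeasure ((measurable_errorIntegrand hh).enorm.pow_const α), estError,
    hf.normPow_eq hα (by fun_prop), hg.normPow_eq hα hh]
  simp only [errorIntegrand, Sum.elim_inl, Sum.elim_inr, neg_dotProduct, enorm_neg]

theorem lintegral_errorIntegrand_sub (hα : 1 < α) (hf : IsDensityOf α Γ f)
    (hg : IsDensityOf α Γ' g) (hh : Measurable h) (hh' : Measurable h') :
    ∫⁻ p, ‖errorIntegrand N a h p - errorIntegrand N a h' p‖ₑ ^ α ∂sumMeasure Γ Γ'
      = normPow α (f + g) fun θ => h θ - h' θ := by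
  simp only [enorm_sub_rev (errorIntegrand N a h _)]
  rw [lintegral_sumMeasure (by fun_prop), hf.normPow_add hα hg (by fun_prop),
    hf.normPow_eq hα (by fun_prop), hg.normPow_eq hα (by fun_prop)]
  simp only [errorIntegrand, Sum.elim_inl, Sum.elim_inr, ← sub_dotProduct, sub_sub_sub_cancel_left,
    neg_sub_neg]

theorem isNegInvariant_map_errorIntegrand (hf : IsDensityOf α Γ f) (hg : IsDensityOf α Γ' g)
    (hh : Measurable h) : ((sumMeasure Γ Γ').map (errorIntegrand N a h)).IsNegInvariant := by
  have hsub : Measurable fun θ => symbolA N a θ - h θ := by fun_prop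
  have := hf.isNegInvariant_map_dotProduct hsub
  have := hg.isNegInvariant_map_dotProduct hh.neg
  exact isNegInvariant_map_sumMeasure (measurable_dotProduct_snd hsub)
    (measurable_dotProduct_snd hh.neg)

theorem IsStableIntegral.stableNormPow_eq_estError (hα : 1 < α) (hf : IsDensityOf α Γ f)
    (hg : IsDensityOf α Γ' g) (hh : Measurable h) {X : Ω → ℂ}
    (hX : IsStableIntegral α P X (sumMeasure Γ Γ') (errorIntegrand N a h)) :
    stableNormPow α P X = estError α N a h f g := by
  have hΓ := hf.finite
  have hΓ' := hg.finite
  have hneg := isNegInvariant_map_errorIntegrand (N := N) (a := a) hf hg hh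
  rw [hX.stableNormPow_eq (zero_lt_one.trans hα), lintegral_errorIntegrand hα hf hg hh]

theorem tendsto_estError (hα : 1 < α) (hf : IsSpectralDensity α f) (hg : IsSpectralDensity α g)
    {v : ℕ → ℝ → Fin T → ℂ} (hv : ∀ m, Measurable (v m)) (hh : Measurable h)
    (hvh : Tendsto (fun m => normPow α (f + g) fun θ => v m θ - h θ) atTop (𝓝 0)) :
    Tendsto (fun m => estError α N a (v m) f g) atTop (𝓝 (estError α N a h f g)) := by
  obtain ⟨Γ, hf⟩ := hf
  obtain ⟨Γ', hg⟩ := hg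
  simp only [← lintegral_errorIntegrand hα hf hg hh, ← lintegral_errorIntegrand hα hf hg (hv _)]
  refine tendsto_lintegral_enorm_rpow hα.le
    (fun m => (measurable_errorIntegrand (hv m)).aestronglyMeasurable)
    (measurable_errorIntegrand hh).aestronglyMeasurable ?_
  simpa only [lintegral_errorIntegrand_sub hα hf hg (hv _) hh] using hvh

theorem isStableIntegral_functionalA_sub_linComb (hα : 0 ≤ α)
    (hξ : ∀ c, IsStableIntegral α P (linComb c ξ) Γ fun p => trigPoly c p.1 ⬝ᵥ p.2)
    (hη : ∀ c, IsStableIntegral α P (linComb c η) Γ' fun p => trigPoly c p.1 ⬝ᵥ p.2)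
    (hξm : ∀ n, Measurable (ξ n)) (hηm : ∀ n, Measurable (η n))
    (hindep : IndepFun (fun ω n => ξ n ω) (fun ω n => η n ω) P) (c : ℤ →₀ (Fin T → ℂ)) :
    IsStableIntegral α P (fun ω => functionalA N a ξ ω - linComb c (ξ + η) ω) (sumMeasure Γ Γ')
      (errorIntegrand N a (trigPoly c)) := by
  have hlin (d : ℤ →₀ (Fin T → ℂ)) : Measurable (linComb d fun n (z : ℤ → Fin T → ℂ) => z n) :=
    measurable_linComb measurable_pi_apply d
  have hindep' : IndepFun (linComb (symbolCoeff N a - c) ξ) (linComb (-c) η) P :=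
    hindep.comp (hlin _) (hlin _)
  convert (hξ (symbolCoeff N a - c)).add_of_indepFun hα (hη (-c)) hindep'
    (measurable_linComb hξm _).aemeasurable (measurable_linComb hηm _).aemeasurable using 1
  · funext ω
    rw [Pi.add_apply, (isLinearMap_linComb ξ ω).map_sub, (isLinearMap_linComb η ω).map_neg,
      linComb_symbolCoeff, linComb_add_right]
    ring
  · simp only [errorIntegrand, (isLinearMap_trigPoly _).map_sub, (isLinearMap_trigPoly _).map_neg,
      trigPoly_symbolCoeff]

theorem isLinearEstimate_linComb [IsProbabilityMeasure P] {ζ : ℤ → Ω → Fin T → ℂ}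
    (hζ : ∀ n, Measurable (ζ n)) {c : ℤ →₀ (Fin T → ℂ)} (hc : AvoidsGap N c) :
    IsLinearEstimate α P N ζ (linComb c ζ) :=
  ⟨measurable_linComb hζ c, fun _ => c, fun _ => hc, by
    simp only [sub_self, stableNormPow_zero, tendsto_const_nhds]⟩

theorem IsCharacteristicOf.stableNormPow_eq_estError [IsProbabilityMeasure P] (hα : 1 < α)
    (hξ : IsHarmonizable α P ξ f) (hη : IsHarmonizable α P η g)
    (hindep : IndepFun (fun ω n => ξ n ω) (fun ω n => η n ω) P) {Y : Ω → ℂ} (hY : Measurable Y)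
    (hh : IsCharacteristicOf α P N ξ η f g Y h) :
    stableNormPow α P (fun ω => functionalA N a ξ ω - Y ω) = estError α N a h f g := by
  have hα0 : 0 ≤ α := zero_le_one.trans hα.le
  obtain ⟨Γ, hf, hξstable⟩ := hξ.exists_isStableIntegral hα0
  obtain ⟨Γ', hg, hηstable⟩ := hη.exists_isStableIntegral hα0
  obtain ⟨hhm, c, -, hcY, hch⟩ := hh
  have hA := measurable_functionalA hξ.1 N a
  refine IsStableIntegral.stableNormPow_eq_estError hα hf hg hhm <| .of_tendsto hα.le
    (fun m => isStableIntegral_functionalA_sub_linComb hα0 hξstable hηstable hξ.1 hη.1 hindep (c m))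
    (fun m => (hA.sub (measurable_linComb (fun n => (hξ.1 n).add (hη.1 n)) (c m))).aemeasurable)
    (hA.sub hY).aemeasurable (measurable_errorIntegrand hhm) ?_ ?_
  · simpa only [sub_sub_sub_cancel_left] using hcY
  · simpa only [lintegral_errorIntegrand_sub hα hf hg (measurable_trigPoly _) hhm] using hch

theorem isCharacteristicOf_trigPoly [IsProbabilityMeasure P] {c : ℤ →₀ (Fin T → ℂ)}
    (hc : AvoidsGap N c) :
    IsCharacteristicOf α P N ξ η f g (linComb c (ξ + η)) (trigPoly c) :=
  ⟨measurable_trigPoly c, fun _ => c, fun _ => hc, by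
    simp only [sub_self, stableNormPow_zero, tendsto_const_nhds], by
    simp [normPow, covForm]⟩

theorem IsOptimalCharacteristic.isMinOn_estError [IsProbabilityMeasure P] (hα : 1 < α)
    (hξ : IsHarmonizable α P ξ f) (hη : IsHarmonizable α P η g)
    (hindep : IndepFun (fun ω n => ξ n ω) (fun ω n => η n ω) P) {h₀ : ℝ → Fin T → ℂ}
    (hh₀ : IsOptimalCharacteristic α P N a ξ η f g h₀) :
    IsMinOn (fun h => estError α N a h f g) (estimateSpace α N (f + g)) h₀ := by
  obtain ⟨Y, ⟨⟨hYm, -⟩, hYmin⟩, hYh₀⟩ := hh₀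
  rintro h ⟨hhm, c, hgap, hch⟩
  have hf : IsSpectralDensity α f := hξ.2.imp fun _ => And.left
  have hg : IsSpectralDensity α g := hη.2.imp fun _ => And.left
  have hζm (n : ℤ) : Measurable ((ξ + η) n) := (hξ.1 n).add (hη.1 n)
  refine ge_of_tendsto' (tendsto_estError hα hf hg (fun m => measurable_trigPoly (c m)) hhm hch)
    fun m => ?_
  calc estError α N a h₀ f g
      = stableNormPow α P fun ω => functionalA N a ξ ω - Y ω :=
        (hYh₀.stableNormPow_eq_estError hα hξ hη hindep hYm).symm
    _ ≤ stableNormPow α P fun ω => functionalA N a ξ ω - linComb (c m) (ξ + η) ω :=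
        hYmin _ (isLinearEstimate_linComb hζm (hgap m))
    _ = estError α N a (trigPoly (c m)) f g :=
        (isCharacteristicOf_trigPoly (hgap m)).stableNormPow_eq_estError hα hξ hη hindep
          (measurable_linComb hζm (c m))

end Error

/-! ### The saddle point -/

section SaddlePoint

variable {T N : ℕ} {α : ℝ} {a : ℕ → Fin T → ℂ} {Df Dg : Set (ℝ → Matrix (Fin T) (Fin T) ℂ)}
  {f₀ g₀ : ℝ → Matrix (Fin T) (Fin T) ℂ} {h₀ : ℝ → Fin T → ℂ}

theorem optimalError_eq_of_isMinOn {f g : ℝ → Matrix (Fin T) (Fin T) ℂ}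
    (hmem : h₀ ∈ estimateSpace α N (f + g))
    (hmin : IsMinOn (fun h => estError α N a h f g) (estimateSpace α N (f + g)) h₀) :
    optimalError α N a f g = estError α N a h₀ f g :=
  le_antisymm (iInf₂_le h₀ hmem) (le_iInf₂ hmin)

theorem estError_le_worstError (h : ℝ → Fin T → ℂ) {f g : ℝ → Matrix (Fin T) (Fin T) ℂ}
    (hf : f ∈ Df) (hg : g ∈ Dg) : estError α N a h f g ≤ worstError α N a Df Dg h :=
  le_iSup₂_of_le f hf (le_iSup₂_of_le g hg le_rfl)

namespace SolvesConstrained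

theorem worstError_eq (hsol : SolvesConstrained α N a Df Dg h₀ f₀ g₀) :
    worstError α N a Df Dg h₀ = estError α N a h₀ f₀ g₀ :=
  le_antisymm (iSup₂_le fun f hf => iSup₂_le fun g hg => hsol.2.2 f hf g hg)
    (estError_le_worstError h₀ hsol.1 hsol.2.1)

theorem isLeastFavorable (hsol : SolvesConstrained α N a Df Dg h₀ f₀ g₀)
    (hH : h₀ ∈ commonSpace α N Df Dg)
    (hmin : IsMinOn (fun h => estError α N a h f₀ g₀) (estimateSpace α N (f₀ + g₀)) h₀) :
    IsLeastFavorable α N a Df Dg f₀ g₀ := by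
  obtain ⟨hf₀, hg₀, hmax⟩ := hsol
  refine ⟨hf₀, hg₀, fun f hf g hg => ?_⟩
  calc optimalError α N a f g ≤ estError α N a h₀ f g := iInf₂_le h₀ (hH f hf g hg)
    _ ≤ estError α N a h₀ f₀ g₀ := hmax f hf g hg
    _ = optimalError α N a f₀ g₀ := (optimalError_eq_of_isMinOn (hH f₀ hf₀ g₀ hg₀) hmin).symm

theorem isMinimaxCharacteristic (hsol : SolvesConstrained α N a Df Dg h₀ f₀ g₀)
    (hH : h₀ ∈ commonSpace α N Df Dg)
    (hmin : IsMinOn (fun h => estError α N a h f₀ g₀) (estimateSpace α N (f₀ + g₀)) h₀) :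
    IsMinimaxCharacteristic α N a Df Dg h₀ := by
  refine ⟨hH, ⟨f₀, hsol.1, g₀, hsol.2.1, hsol.worstError_eq⟩, fun h hh => ?_⟩
  calc worstError α N a Df Dg h₀ = estError α N a h₀ f₀ g₀ := hsol.worstError_eq
    _ ≤ estError α N a h f₀ g₀ := hmin (hh f₀ hsol.1 g₀ hsol.2.1)
    _ ≤ worstError α N a Df Dg h := estError_le_worstError h hsol.1 hsol.2.1

end SolvesConstrained

end SaddlePoint

end HSaS

theorem mainTheorem11_general {Ω : Type*} [MeasurableSpace Ω] (P : Measure Ω)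
    [IsProbabilityMeasure P] (α : ℝ) (hα : 1 < α) (T N : ℕ) (a : ℕ → Fin T → ℂ)
    (Df Dg : Set (ℝ → Matrix (Fin T) (Fin T) ℂ))
    (_hDf : ∀ f ∈ Df, HSaS.IsSpectralDensity α f)
    (_hDg : ∀ g ∈ Dg, HSaS.IsSpectralDensity α g)
    (ξ η : ℤ → Ω → Fin T → ℂ) (f₀ g₀ : ℝ → Matrix (Fin T) (Fin T) ℂ)
    (hξ : HSaS.IsHarmonizable α P ξ f₀) (hη : HSaS.IsHarmonizable α P η g₀)
    (hindep : IndepFun (fun ω n => ξ n ω) (fun ω n => η n ω) P)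
    (h₀ : ℝ → Fin T → ℂ)
    (hh₀ : HSaS.IsOptimalCharacteristic α P N a ξ η f₀ g₀ h₀)
    (hsol : HSaS.SolvesConstrained α N a Df Dg h₀ f₀ g₀)
    (hH : h₀ ∈ HSaS.commonSpace α N Df Dg) :
    HSaS.IsLeastFavorable α N a Df Dg f₀ g₀ ∧
    HSaS.optimalError α N a f₀ g₀ = HSaS.estError α N a h₀ f₀ g₀ ∧
    HSaS.IsMinimaxCharacteristic α N a Df Dg h₀ := by
  have hmin := hh₀.isMinOn_estError hα hξ hη hindep
  have hmem : h₀ ∈ HSaS.estimateSpace α N (f₀ + g₀) := hH f₀ hsol.1 g₀ hsol.2.1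
  exact ⟨hsol.isLeastFavorable hH hmin, HSaS.optimalError_eq_of_isMinOn hmem hmin,
    hsol.isMinimaxCharacteristic hH hmin⟩

theorem mainTheorem11 {Ω : Type*} [MeasurableSpace Ω] (P : Measure Ω) [IsProbabilityMeasure P]
    (α : ℝ) (hα : 1 < α) (hα2 : α ≤ 2) (T N : ℕ) (a : ℕ → Fin T → ℂ)
    (Df Dg : Set (ℝ → Matrix (Fin T) (Fin T) ℂ))
    (hDf : ∀ f ∈ Df, HSaS.IsSpectralDensity α f)
    (hDg : ∀ g ∈ Dg, HSaS.IsSpectralDensity α g)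
    (ξ η : ℤ → Ω → Fin T → ℂ) (f₀ g₀ : ℝ → Matrix (Fin T) (Fin T) ℂ)
    (hξ : HSaS.IsHarmonizable α P ξ f₀) (hη : HSaS.IsHarmonizable α P η g₀)
    (hindep : IndepFun (fun ω n => ξ n ω) (fun ω n => η n ω) P)
    (hmin : HSaS.MinimalityCondition α f₀ g₀)
    (h₀ : ℝ → Fin T → ℂ)
    (hh₀ : HSaS.IsOptimalCharacteristic α P N a ξ η f₀ g₀ h₀)
    (hsol : HSaS.SolvesConstrained α N a Df Dg h₀ f₀ g₀)
    (hH : h₀ ∈ HSaS.commonSpace α N Df Dg) :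
    HSaS.IsLeastFavorable α N a Df Dg f₀ g₀ ∧
    HSaS.optimalError α N a f₀ g₀ = HSaS.estError α N a h₀ f₀ g₀ ∧
    HSaS.IsMinimaxCharacteristic α N a Df Dg h₀ := by
  exact mainTheorem11_general P α hα T N a Df Dg hDf hDg ξ η f₀ g₀ hξ hη hindep h₀ hh₀ hsol hH
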